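/- Write $\mathbb{N}=\{0,1,2,\dots\}$, $[k]_q=1+q+\cdots+q^{k-1}$ for $k\in\mathbb{N}$ (so $[0]_q=0$), and let $n\in\mathbb{N}$. For $\mathbf{x}=(x_1,\dots,x_n)\in\mathbb{N}^n$, let $\mathrm{PF}(\mathbf{x})$ be the set of $\mathbf{x}$-parking functions: the sequences $\alpha=(\alpha_1,\dots,\alpha_n)\in\mathbb{N}^n$ whose weakly increasing rearrangement $\alpha_{i_1}\le\cdots\le\alpha_{i_n}$ satisfies $\alpha_{i_j}\le\left(\sum_{k=1}^{j}x_k\right)-1$ for all $1\le j\le n$. For $\alpha\in\mathrm{PF}(\mathbf{x})$ put $\mathrm{rsum}(\alpha)=\left(\sum_{i=1}^{n}(n+1-i)x_i\right)-n-\sum_{i=1}^{n}\alpha_i$. A tree $T$ with vertex set $\{0,1,\dots,n\}$ is always rooted at $0$. Write $i\le_T j$ if the path in $T$ from $j$ to $0$ passes through $i$, write $\mathrm{par}_T(j)$ for the parent of a vertex $j\ne 0$, and let $\mathrm{outdeg}_T(i)$ be the number of children of $i$. Two non-root vertices are siblings if they have the same parent. Let $\mathrm{RPT}(n+1)$ be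 the set of rooted plane trees on $n+1$ vertices, labeled in depth-first order, that is, the set of trees $T$ with vertex set $\{0,\dots,n\}$ such that $i\le_T j$ implies $i\le j$ for all $1\le i,j\le n$, and $i\le_T k$ implies $i\le_T j$ for all $1\le i<j<k\le n$. For $T\in\mathrm{RPT}(n+1)$, let $\mathrm{AVO}(T)$ be the set of strict total orders $\prec$ on $\{1,\dots,n\}$ such that $j\prec i$ whenever $1\le i<j\le n$ are siblings. **Theorem.** For every $\mathbf{x}\in\mathbb{N}^n$, $$\sum_{\alpha\in\mathrm{PF}(\mathbf{x})}q^{\mathrm{rsum}(\alpha)}=\sum_{T\in\mathrm{RPT}(n+1)}\left(\sum_{\prec\,\in\mathrm{AVO}(T)}q^{\sum_{i\le_T j,\;j\prec i}x_{\mathrm{par}_T(i)+1}}\right)\left(\prod_{i=1}^{n}[x_i]_q^{\mathrm{outdeg}_T(i-1)}\right)$$ in $\mathbb{Z}[q,q^{-1}]$, where the sum in the exponent runs over pairs $(i,j)$ of non-root vertices. For $\mathbf{x}=(1,\dots,1)$ this recovers Kreweras's identity. That is, the left side equals $\sum_{\alpha\in\mathrm{PF}(n)}q^{\binom{n}{2}-\sum_i\alpha_i}$,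 where $\mathrm{PF}(n)$ is the set of $\alpha\in\mathbb{N}^n$ whose weakly increasing rearrangement satisfies $\alpha_{i_j}\le j-1$ for all $1\le j\le n$; the right side equals $\sum_{T}q^{\mathrm{inv}(T)}$, summed over all trees $T$ with vertex set $\{0,\dots,n\}$, where $\mathrm{inv}(T)$ is the number of pairs $1\le i<j\le n$ such that the path from $i$ to $0$ passes through $j$; and hence $$\sum_{\alpha\in\mathrm{PF}(n)}q^{\binom{n}{2}-\sum_i\alpha_i}=\sum_{T}q^{\mathrm{inv}(T)}.$$ -/

import Mathlib

/-!
Conventions. A vector `(x₁, …, xₙ) ∈ ℕⁿ` is a function `x : Fin n → ℕ`, with `xᵢ₊₁ = x i`.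
Trees have vertex set `{0, 1, …, n} = Fin (n + 1)` and root `0`. The non-root vertices
`1, …, n` are `i.succ` for `i : Fin n`. The power `q ^ k`, for an integer `k`, is the monomial
`LaurentPolynomial.T k` in the ring `ℤ[q, q⁻¹] = LaurentPolynomial ℤ`.
-/

namespace VectorParking

/-! ### Parking functions -/

/-- `α` is an `x`-parking function: its weakly increasing rearrangement
`α_{i₁} ≤ ⋯ ≤ α_{iₙ}` satisfies `α_{i_j} ≤ (x₁ + ⋯ + x_j) - 1` for all `1 ≤ j ≤ n`. -/
def IsVectorParkingFunction {n : ℕ} (x α : Fin n → ℕ) : Prop :=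
  ∀ j : Fin n, (α (Tuple.sort α j) : ℤ) ≤ (∑ k ∈ Finset.Iic j, (x k : ℤ)) - 1

theorem finite_setOf_isVectorParkingFunction {n : ℕ} (x : Fin n → ℕ) :
    {α : Fin n → ℕ | IsVectorParkingFunction x α}.Finite := by
  refine (Set.finite_Iic (fun _ : Fin n => ∑ k, x k)).subset ?_
  intro α hα i
  have h := hα ((Tuple.sort α).symm i)
  rw [Equiv.apply_symm_apply] at h
  have h2 : ∑ k ∈ Finset.Iic ((Tuple.sort α).symm i), (x k : ℤ) ≤ ∑ k, (x k : ℤ) :=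
    Finset.sum_le_sum_of_subset_of_nonneg (Finset.subset_univ _) (fun _ _ _ => by positivity)
  have h3 : (α i : ℤ) ≤ ((∑ k, x k : ℕ) : ℤ) := by
    push_cast
    linarith
  exact_mod_cast h3

/-- `PF(x)`, the finite set of `x`-parking functions. -/
noncomputable def vectorPF {n : ℕ} (x : Fin n → ℕ) : Finset (Fin n → ℕ) :=
  (finite_setOf_isVectorParkingFunction x).toFinset

/-- The reversed sum `(∑_{i=1}^{n} (n + 1 - i) xᵢ) - n - ∑_{i=1}^{n} αᵢ`, an integer. -/
def rsum {n : ℕ} (x α : Fin n → ℕ) : ℤ :=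
  (∑ i : Fin n, ((n : ℤ) + 1 - ((i : ℤ) + 1)) * (x i : ℤ)) - (n : ℤ) - ∑ i : Fin n, (α i : ℤ)

/-- `α` is a (classical) parking function of length `n`: its weakly increasing rearrangement
satisfies `α_{i_j} ≤ j - 1` for all `1 ≤ j ≤ n`. -/
def IsParkingFunction {n : ℕ} (α : Fin n → ℕ) : Prop :=
  ∀ j : Fin n, α (Tuple.sort α j) ≤ (j : ℕ)

theorem finite_setOf_isParkingFunction (n : ℕ) :
    {α : Fin n → ℕ | IsParkingFunction α}.Finite := by
  refine (Set.finite_Iic (fun _ : Fin n => n)).subset ?_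
  intro α hα i
  have h := hα ((Tuple.sort α).symm i)
  rw [Equiv.apply_symm_apply] at h
  exact h.trans (Fin.is_lt _).le

/-- `PF(n)`, the finite set of classical parking functions of length `n`. -/
noncomputable def classicalPF (n : ℕ) : Finset (Fin n → ℕ) :=
  (finite_setOf_isParkingFunction n).toFinset

/-- The reversed sum `binom(n, 2) - ∑ αᵢ` of a classical parking function. -/
def classicalRsum {n : ℕ} (α : Fin n → ℕ) : ℤ :=
  (n.choose 2 : ℤ) - ∑ i : Fin n, (α i : ℤ)

/-! ### Trees on `{0, …, n}` rooted at `0` -/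

/-- Labeled trees with vertex set `{0, …, n}`, always rooted at `0`. -/
abbrev LabeledTree (n : ℕ) : Type :=
  {G : SimpleGraph (Fin (n + 1)) // G.IsTree}

noncomputable instance (n : ℕ) : Fintype (LabeledTree n) := Fintype.ofFinite _

namespace LabeledTree

variable {n : ℕ}

/-- The unique path in `T` from `j` to the root. -/
noncomputable def pathToRoot (T : LabeledTree n) (j : Fin (n + 1)) : T.1.Walk j 0 :=
  (T.2.existsUnique_path j 0).choose

theorem isPath_pathToRoot (T : LabeledTree n) (j : Fin (n + 1)) : (T.pathToRoot j).IsPath :=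
  (T.2.existsUnique_path j 0).choose_spec.1

/-- The tree order: `i ≤_T j` iff the unique path from `j` to the root passes through `i`. -/
def TreeLE (T : LabeledTree n) (i j : Fin (n + 1)) : Prop :=
  i ∈ (T.pathToRoot j).support

/-- The parent of a non-root vertex `j`: the vertex after `j` on the path from `j` to the root.
(It is only used for `j ≠ 0`.) -/
noncomputable def par (T : LabeledTree n) (j : Fin (n + 1)) : Fin (n + 1) :=
  (T.pathToRoot j).snd

theorem treeLE_par (T : LabeledTree n) (j : Fin (n + 1)) : T.TreeLE (T.par j) j :=
  (T.pathToRoot j).getVert_mem_support 1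

theorem par_ne (T : LabeledTree n) {j : Fin (n + 1)} (hj : j ≠ 0) : T.par j ≠ j :=
  ((T.pathToRoot j).adj_snd (SimpleGraph.Walk.not_nil_of_ne hj)).ne'

open Classical in
/-- The number of children of `i`. -/
noncomputable def outdeg (T : LabeledTree n) (i : Fin (n + 1)) : ℕ :=
  (Finset.univ.filter fun j : Fin n => T.par j.succ = i).card

open Classical in
/-- The inversion number of a labeled tree: the number of pairs `(i, j)` with `1 ≤ i < j ≤ n`
such that the path from `i` to `0` passes through `j`. -/
noncomputable def inv (T : LabeledTree n) : ℕ :=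
  (Finset.univ.filter fun p : Fin n × Fin n => p.1 < p.2 ∧ T.TreeLE p.2.succ p.1.succ).card

open Classical in
/-- The inversions of `T` with respect to a relation `r` (written `≺`) on the non-root vertices:
the pairs `(i, j)` of non-root vertices with `i ≤_T j` and `j ≺ i`. The element `i` of `Fin n`
stands for the non-root vertex `i.succ`. -/
noncomputable def inversions (T : LabeledTree n) (r : Fin n → Fin n → Prop) :
    Finset (Fin n × Fin n) :=
  Finset.univ.filter fun p : Fin n × Fin n => T.TreeLE p.1.succ p.2.succ ∧ r p.2 p.1

/-- The conditions for `T` to be a rooted plane tree with its vertices labeled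
`0, 1, …, n` in depth-first (preorder) order. -/
def IsPlane (T : LabeledTree n) : Prop :=
  (∀ i j : Fin n, T.TreeLE i.succ j.succ → i ≤ j) ∧
  (∀ i j k : Fin n, i < j → j < k → T.TreeLE i.succ k.succ → T.TreeLE i.succ j.succ)

/-- `r` (written `≺`) is an admissible vertex order of `T`: a strict total order on the non-root
vertices for which `j ≺ i` whenever `i < j` are siblings. -/
def IsAdmissible (T : LabeledTree n) (r : Fin n → Fin n → Prop) : Prop :=
  IsStrictTotalOrder (Fin n) r ∧
  ∀ i j : Fin n, i < j → T.par i.succ = T.par j.succ → r j i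

end LabeledTree

/-- `RPT(n + 1)`, the rooted plane trees on `n + 1` vertices. -/
abbrev RPT (n : ℕ) : Type := {T : LabeledTree n // T.IsPlane}

noncomputable instance (n : ℕ) : Fintype (RPT n) := Fintype.ofFinite _

/-- `AVO(T)`, the admissible vertex orders of `T`. -/
abbrev AVO {n : ℕ} (T : LabeledTree n) : Type :=
  {r : Fin n → Fin n → Prop // T.IsAdmissible r}

noncomputable instance {n : ℕ} (T : LabeledTree n) : Fintype (AVO T) := Fintype.ofFinite _

theorem RPT.par_lt {n : ℕ} (T : RPT n) (i : Fin n) : (T.1.par i.succ : ℕ) < n := by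
  rcases Fin.eq_zero_or_eq_succ (T.1.par i.succ) with h | ⟨j, hj⟩
  · rw [h]
    exact i.pos
  · have h1 := T.1.treeLE_par i.succ
    have h2 := T.1.par_ne (Fin.succ_ne_zero i)
    rw [hj] at h1 h2 ⊢
    have h3 : j ≤ i := T.2.1 j i h1
    have h4 : j ≠ i := fun h => h2 (by rw [h])
    have h5 : j < i := lt_of_le_of_ne h3 h4
    rw [Fin.lt_def] at h5
    have := i.is_lt
    simp only [Fin.val_succ]
    omega

/-- The entry `x_{par_T(i) + 1}` of `x`, for a non-root vertex `i` of a rooted plane tree `T`. -/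
noncomputable def parEntry {n : ℕ} (x : Fin n → ℕ) (T : RPT n) (i : Fin n) : ℕ :=
  x ⟨(T.1.par i.succ : ℕ), T.par_lt i⟩

/-- The `q`-number `[k]_q = 1 + q + ⋯ + q^(k-1)`. -/
noncomputable def qNumber (k : ℕ) : LaurentPolynomial ℤ :=
  ∑ i ∈ Finset.range k, LaurentPolynomial.T (i : ℤ)

end VectorParking

open VectorParking

/-!
Both identities count depth-first searches. A depth-first search of a tree with distinctly labeled
non-root vertices, in which the children of a vertex are visited by decreasing label, is recorded by
the parents and the labels of the vertices in the order of discovery.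

* The vertices in the order of discovery form a plane tree, and comparing their labels gives an
  admissible vertex order.
* Forgetting the order of discovery leaves a labeled tree, and an inversion of the labeled tree is
  an inversion of the plane tree.
* A parking function `α` also prescribes a search. When the `k`-th non-root vertex is discovered and
  has label `l`, lay out the vertices that could still receive a child labeled `l` in increasing
  order, as consecutive segments of lengths given by `x`, starting at `α l`. Its parent is the
  vertex whose segment contains `S - 1`, where `S = x₁ + ⋯ + x_k`. The parking functions that
  prescribe a given search thus form a product of intervals, whose lengths are the entries of `x` at
  the parents, and this contributes the factors `[xᵢ]_q`. The segments before that of the parent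
  have the total length `w`, which is the contribution to the exponent of the inversions whose
  second vertex is the one discovered: the ancestors with larger label are matched with the
  vertices skipped.

In both of the last two cases the search is recovered from the object because each step is the
lexicographically greatest pair (parent, label) among those that are possible.
-/

namespace VectorParking

/-! ### Greedy sequences -/

section Greedy

variable {ι β : Type*} {C : ι → (ι → β) → Set β}

/-- Each term of `f` is the greatest candidate. The set `C k f` of candidates for the term `k` is
meant to depend only on the terms of `f` before `k`. -/
def IsGreedy [Preorder β] (C : ι → (ι → β) → Set β) (f : ι → β) : Prop :=
  ∀ k, IsGreatest (C k f) (f k)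

theorem exists_forall_eq_of_wellFoundedLT [LT ι] [WellFoundedLT ι] [Nonempty (ι → β)]
    {F : ι → (ι → β) → β} (hF : ∀ k f g, (∀ u < k, f u = g u) → F k f = F k g) :
    ∃ f : ι → β, ∀ k, f k = F k f := by
  classical
  let extend (k : ι) (rec : ∀ u, u < k → β) : β :=
    F k fun u => if h : u < k then rec u h else Classical.arbitrary (ι → β) u
  refine ⟨(wellFounded_lt (α := ι)).fix extend, fun k => ?_⟩
  rw [WellFounded.fix_eq]
  exact hF _ _ _ fun u hu => dif_pos hu

theorem existsUnique_isGreedy [Preorder ι] [WellFoundedLT ι] [PartialOrder β] [Nonempty (ι → β)]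
    (hC : ∀ k f g, (∀ u < k, f u = g u) → C k f = C k g)
    (hgreatest : ∀ k f, ∃ b, IsGreatest (C k f) b) : ∃! f, IsGreedy C f := by
  choose F hF using hgreatest
  obtain ⟨f, hf⟩ := exists_forall_eq_of_wellFoundedLT (F := F) fun k f g hfg =>
    (hF k f).unique (hC k f g hfg ▸ hF k g)
  have hfC : IsGreedy C f := fun k => by rw [hf k]; exact hF k f
  refine ⟨f, hfC, fun g hg => funext fun k => ?_⟩
  induction k using WellFoundedLT.induction with
  | _ k ih => exact (hg k).unique (hC k f g (fun u hu => (ih u hu).symm) ▸ hfC k)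

end Greedy

/-! ### Trees and parent functions -/

variable {n : ℕ}

namespace LabeledTree

theorem eq_pathToRoot (T : LabeledTree n) {j : Fin (n + 1)} {w : T.1.Walk j 0} (hw : w.IsPath) :
    w = T.pathToRoot j :=
  (T.2.existsUnique_path j 0).unique hw (T.isPath_pathToRoot j)

theorem adj_par (T : LabeledTree n) {j : Fin (n + 1)} (hj : j ≠ 0) : T.1.Adj j (T.par j) :=
  (T.pathToRoot j).adj_snd (SimpleGraph.Walk.not_nil_of_ne hj)

theorem pathToRoot_zero (T : LabeledTree n) : T.pathToRoot 0 = SimpleGraph.Walk.nil :=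
  (T.eq_pathToRoot SimpleGraph.Walk.IsPath.nil).symm

theorem pathToRoot_eq_cons (T : LabeledTree n) {j : Fin (n + 1)} (hj : j ≠ 0) :
    T.pathToRoot j = SimpleGraph.Walk.cons (T.adj_par hj) (T.pathToRoot (T.par j)) := by
  have htail : (T.pathToRoot j).tail = T.pathToRoot (T.par j) :=
    T.eq_pathToRoot (T.isPath_pathToRoot j).tail
  rw [← htail]
  exact (SimpleGraph.Walk.cons_tail_eq _ (SimpleGraph.Walk.not_nil_of_ne hj)).symm

theorem treeLE_zero_iff (T : LabeledTree n) {i : Fin (n + 1)} : T.TreeLE i 0 ↔ i = 0 := by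
  simp [TreeLE, pathToRoot_zero]

theorem treeLE_iff_eq_or_treeLE_par (T : LabeledTree n) {i j : Fin (n + 1)} (hj : j ≠ 0) :
    T.TreeLE i j ↔ i = j ∨ T.TreeLE i (T.par j) := by
  simp [TreeLE, T.pathToRoot_eq_cons hj]

theorem zero_treeLE (T : LabeledTree n) (j : Fin (n + 1)) : T.TreeLE 0 j :=
  SimpleGraph.Walk.end_mem_support _

theorem TreeLE.length_lt {T : LabeledTree n} {i j : Fin (n + 1)} (h : T.TreeLE i j)
    (hij : i ≠ j) : (T.pathToRoot i).length < (T.pathToRoot j).length := by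
  rw [← T.eq_pathToRoot ((T.isPath_pathToRoot j).dropUntil h)]
  exact SimpleGraph.Walk.length_dropUntil_lt_length h hij

theorem par_eq_of_adj_of_not_treeLE (T : LabeledTree n) {a b : Fin (n + 1)} (h : T.1.Adj a b)
    (hab : ¬ T.TreeLE a b) : T.par a = b := by
  rw [par, ← T.eq_pathToRoot ((T.isPath_pathToRoot b).cons (h := h) hab)]
  simp

theorem adj_iff_par_eq (T : LabeledTree n) {a b : Fin (n + 1)} :
    T.1.Adj a b ↔ (a ≠ 0 ∧ T.par a = b) ∨ (b ≠ 0 ∧ T.par b = a) := by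
  constructor
  · intro h
    by_cases hab : T.TreeLE a b
    · have hba : ¬ T.TreeLE b a := fun hba => lt_asymm (hab.length_lt h.ne) (hba.length_lt h.ne')
      refine Or.inr ⟨?_, T.par_eq_of_adj_of_not_treeLE h.symm hba⟩
      rintro rfl
      exact hba (T.zero_treeLE a)
    · refine Or.inl ⟨?_, T.par_eq_of_adj_of_not_treeLE h hab⟩
      rintro rfl
      exact hab (T.zero_treeLE b)
  · rintro (⟨h, rfl⟩ | ⟨h, rfl⟩)
    · exact T.adj_par h
    · exact (T.adj_par h).symm

theorem ext_par {T T' : LabeledTree n} (h : ∀ k : Fin n, T.par k.succ = T'.par k.succ) :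
    T = T' := by
  have hpar : ∀ a, a ≠ 0 → T.par a = T'.par a := by
    rintro a ha
    obtain ⟨k, rfl⟩ := Fin.exists_succ_eq.2 ha
    exact h k
  ext a b
  rw [adj_iff_par_eq, adj_iff_par_eq]
  exact or_congr (and_congr_right fun ha => by rw [hpar a ha])
    (and_congr_right fun hb => by rw [hpar b hb])

end LabeledTree

/-- The graph in which each non-root vertex `k.succ` is joined to its prescribed parent `p k`. -/
def parentGraph (p : Fin n → Fin (n + 1)) : SimpleGraph (Fin (n + 1)) :=
  SimpleGraph.fromEdgeSet (Set.range fun k => s(k.succ, p k))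

section ParentGraph

variable {p : Fin n → Fin (n + 1)} {β : Type*} [Preorder β] {rank : Fin (n + 1) → β}

theorem parentGraph_adj (hrank : ∀ k, rank (p k) < rank k.succ) (k : Fin n) :
    (parentGraph p).Adj k.succ (p k) :=
  (SimpleGraph.fromEdgeSet_adj _).2 ⟨⟨k, rfl⟩, fun h => (hrank k).ne (congrArg rank h.symm)⟩

variable [WellFoundedLT β]

theorem connected_parentGraph (hrank : ∀ k, rank (p k) < rank k.succ) :
    (parentGraph p).Connected := by
  have hroot : ∀ a, (parentGraph p).Reachable a 0 := fun a => by
    induction a using (InvImage.wf rank wellFounded_lt).induction with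
    | _ a ih =>
      rcases Fin.eq_zero_or_eq_succ a with rfl | ⟨k, rfl⟩
      · exact SimpleGraph.Reachable.refl _
      · exact (parentGraph_adj hrank k).reachable.trans (ih _ (hrank k))
  exact { preconnected := fun a b => (hroot a).trans (hroot b).symm }

theorem card_edgeSet_parentGraph_le (p : Fin n → Fin (n + 1)) :
    Nat.card (parentGraph p).edgeSet ≤ n :=
  calc (parentGraph p).edgeSet.ncard
    _ ≤ (Set.range fun k : Fin n => s(k.succ, p k)).ncard :=
      Set.ncard_le_ncard (by simp [parentGraph, SimpleGraph.edgeSet_fromEdgeSet])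
        (Set.finite_range _)
    _ ≤ n := by
      rw [← Set.image_univ]
      exact (Set.ncard_image_le Set.finite_univ).trans (by simp)

theorem isTree_parentGraph (hrank : ∀ k, rank (p k) < rank k.succ) : (parentGraph p).IsTree := by
  have hconn := connected_parentGraph hrank
  refine SimpleGraph.isTree_iff_connected_and_card.2 ⟨hconn, le_antisymm ?_ ?_⟩
  · simpa using card_edgeSet_parentGraph_le p
  · exact hconn.card_vert_le_card_edgeSet_add_one

theorem exists_labeledTree_par_eq (hrank : ∀ k, rank (p k) < rank k.succ) :
    ∃ T : LabeledTree n, ∀ k : Fin n, T.par k.succ = p k := by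
  let T : LabeledTree n := ⟨parentGraph p, isTree_parentGraph hrank⟩
  suffices hpar : ∀ a (k : Fin n), k.succ = a → T.par a = p k from ⟨T, fun k => hpar _ k rfl⟩
  intro a
  induction a using (InvImage.wf rank wellFounded_lt).induction with
  | _ a ih =>
    rintro k rfl
    rcases T.adj_iff_par_eq.1 (parentGraph_adj hrank k) with ⟨-, h⟩ | ⟨hne, h⟩
    · exact h
    · obtain ⟨m, hm⟩ := Fin.exists_succ_eq.2 hne
      have hpm : p m = k.succ := (ih (p k) (hrank k) m hm).symm.trans h
      exact absurd ((hrank k).trans (hpm ▸ hm ▸ hrank m)) (lt_irrefl _)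

end ParentGraph

/-! ### Plane trees -/

namespace LabeledTree.IsPlane

variable {T : LabeledTree n}

theorem le_of_treeLE (hT : T.IsPlane) {v w : Fin (n + 1)} (h : T.TreeLE v w) : v ≤ w := by
  rcases Fin.eq_zero_or_eq_succ v with rfl | ⟨i, rfl⟩
  · exact Fin.zero_le w
  rcases Fin.eq_zero_or_eq_succ w with rfl | ⟨j, rfl⟩
  · exact (T.treeLE_zero_iff.1 h).le
  · exact Fin.succ_le_succ_iff.2 (hT.1 i j h)

theorem treeLE_of_le_of_le (hT : T.IsPlane) {v w : Fin (n + 1)} {k : Fin n}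
    (hvk : T.TreeLE v k.succ) (hvw : v < w) (hwk : w ≤ k.succ) : T.TreeLE v w := by
  rcases hwk.eq_or_lt with rfl | hwk
  · exact hvk
  rcases Fin.eq_zero_or_eq_succ v with rfl | ⟨i, rfl⟩
  · exact T.zero_treeLE w
  obtain ⟨j, rfl⟩ := Fin.exists_succ_eq.2 (Fin.ne_zero_of_lt hvw)
  exact hT.2 i j k (Fin.succ_lt_succ_iff.1 hvw) (Fin.succ_lt_succ_iff.1 hwk) hvk

end LabeledTree.IsPlane

namespace RPT

/-- The parent function of a plane tree, in the indexing in which `i : Fin n` stands for the vertex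
`i.succ` as a child and for the vertex `i.castSucc` as a parent. -/
noncomputable def parent (T : RPT n) (i : Fin n) : Fin n := ⟨T.1.par i.succ, T.par_lt i⟩

theorem castSucc_parent (T : RPT n) (i : Fin n) : (T.parent i).castSucc = T.1.par i.succ := rfl

theorem parent_le (T : RPT n) (i : Fin n) : T.parent i ≤ i := by
  rw [← Fin.castSucc_lt_succ_iff, castSucc_parent]
  exact (T.2.le_of_treeLE (T.1.treeLE_par _)).lt_of_ne (T.1.par_ne (Fin.succ_ne_zero i))

theorem parent_le_parent (T : RPT n) {u k : Fin n} (huk : u ≤ k) (hku : T.parent k ≤ u) :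
    T.parent k ≤ T.parent u := by
  have hlt : T.1.par k.succ < u.succ := Fin.castSucc_lt_succ_iff.2 hku
  have hle : T.1.TreeLE (T.1.par k.succ) u.succ :=
    T.2.treeLE_of_le_of_le (T.1.treeLE_par _) hlt (Fin.succ_le_succ_iff.2 huk)
  have hpar := ((T.1.treeLE_iff_eq_or_treeLE_par (Fin.succ_ne_zero u)).1 hle).resolve_left hlt.ne
  exact Fin.castSucc_le_castSucc_iff.1 (T.2.le_of_treeLE hpar)

end RPT

/-! ### Depth-first search -/

/-- The record of a depth-first search of a labeled tree whose vertices `0, …, n` are numbered in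
the order of discovery: step `k` discovers the vertex `k.succ`, which carries the label `label k`
and is a child of `(parent k).castSucc`. The field `lex_lt` says that between a vertex and its child
only descendants of the vertex are discovered, and that siblings are visited by decreasing label. -/
@[ext] structure DFSRun (n : ℕ) where
  parent : Fin n → Fin n
  label : Equiv.Perm (Fin n)
  parent_le : ∀ k, parent k ≤ k
  lex_lt : ∀ u k, u < k → parent k ≤ u → toLex (parent k, label k) < toLex (parent u, label u)

section Pending

variable {f g : Fin n → Fin n ×ₗ Fin n} {k l v : Fin n}

/-- The label `l` is not the label of any step of the search sequence `f` before the step `k`. -/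
def IsFresh (f : Fin n → Fin n ×ₗ Fin n) (k l : Fin n) : Prop :=
  ∀ u < k, (ofLex (f u)).2 ≠ l

/-- The vertices that a depth-first search can still attach the label `l` to, when the steps of `f`
before the step `k` have been made. -/
def pending (f : Fin n → Fin n ×ₗ Fin n) (k l : Fin n) : Finset (Fin n) :=
  {v ∈ Finset.Iic k | ∀ u < k, v ≤ u → toLex (v, l) < f u}

theorem mem_pending : v ∈ pending f k l ↔ v ≤ k ∧ ∀ u < k, v ≤ u → toLex (v, l) < f u := by
  simp [pending]

theorem self_mem_pending (f : Fin n → Fin n ×ₗ Fin n) (k l : Fin n) : k ∈ pending f k l :=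
  mem_pending.2 ⟨le_rfl, fun _ huk hku => absurd hku huk.not_ge⟩

theorem isFresh_congr (h : ∀ u < k, f u = g u) : IsFresh f k l ↔ IsFresh g k l :=
  forall₂_congr fun u hu => by rw [h u hu]

theorem pending_congr (h : ∀ u < k, f u = g u) (l : Fin n) : pending f k l = pending g k l :=
  Finset.filter_congr fun _ _ => forall₂_congr fun u hu => by rw [h u hu]

theorem exists_le_forall_lt_ne {β : Type*} (k : Fin n) (σ : Fin n → β) {τ : Fin n → β}
    (hτ : Function.Injective τ) : ∃ j ≤ k, ∀ u < k, σ u ≠ τ j := by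
  classical
  by_contra! h
  have hsub : (Finset.Iic k).image τ ⊆ (Finset.Iio k).image σ := by
    simpa [Finset.subset_iff] using h
  have hcard := (Finset.card_le_card hsub).trans Finset.card_image_le
  simp [Finset.card_image_of_injective _ hτ] at hcard

end Pending

namespace DFSRun

variable (a : DFSRun n) {u k : Fin n}

theorem parent_le_parent (huk : u ≤ k) (hku : a.parent k ≤ u) : a.parent k ≤ a.parent u := by
  rcases huk.eq_or_lt with rfl | huk
  · exact le_rfl
  rcases Prod.Lex.toLex_lt_toLex.1 (a.lex_lt u k huk hku) with h | h
  · exact h.le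
  · exact h.1.le

/-- The search sequence of a run: its step `k` is the pair of the parent and the label of the
vertex discovered. -/
def step (k : Fin n) : Fin n ×ₗ Fin n := toLex (a.parent k, a.label k)

theorem step_injective : Function.Injective (step : DFSRun n → _) := by
  intro a b h
  have hk : ∀ k, a.parent k = b.parent k ∧ a.label k = b.label k := fun k =>
    Prod.ext_iff.1 (congrFun h k)
  exact DFSRun.ext (funext fun k => (hk k).1) (Equiv.ext fun k => (hk k).2)

instance : Finite (DFSRun n) := Finite.of_injective _ step_injective

noncomputable instance : Fintype (DFSRun n) := Fintype.ofFinite _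

theorem parent_mem_pending (k : Fin n) : a.parent k ∈ pending a.step k (a.label k) :=
  mem_pending.2 ⟨a.parent_le k, fun u => a.lex_lt u k⟩

theorem isFresh_label (k : Fin n) : IsFresh a.step k (a.label k) :=
  fun _ huk h => huk.ne (a.label.injective h)

variable {a} in
theorem exists_label_eq_of_isFresh {l : Fin n} (h : IsFresh a.step k l) :
    ∃ j ≥ k, a.label j = l :=
  ⟨a.label.symm l, not_lt.1 fun hlt => h _ hlt (a.label.apply_symm_apply l),
    a.label.apply_symm_apply l⟩

theorem exists_step_eq {f : Fin n → Fin n ×ₗ Fin n} (hfresh : ∀ k, IsFresh f k (ofLex (f k)).2)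
    (hpending : ∀ k, (ofLex (f k)).1 ∈ pending f k (ofLex (f k)).2) :
    ∃ a : DFSRun n, a.step = f :=
  have hinj : Function.Injective fun k => (ofLex (f k)).2 :=
    Function.Injective.of_lt_imp_ne fun u k huk => hfresh k u huk
  ⟨{ parent := fun k => (ofLex (f k)).1
     label := Equiv.ofBijective _ (Finite.injective_iff_bijective.1 hinj)
     parent_le := fun k => (mem_pending.1 (hpending k)).1
     lex_lt := fun u k => (mem_pending.1 (hpending k)).2 u }, rfl⟩

theorem existsUnique_isGreedy_step
    {C : Fin n → (Fin n → Fin n ×ₗ Fin n) → Set (Fin n ×ₗ Fin n)}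
    (hC : ∀ k f g, (∀ u < k, f u = g u) → C k f = C k g) (hnonempty : ∀ k f, (C k f).Nonempty)
    (hfresh : ∀ k f, ∀ e ∈ C k f, IsFresh f k (ofLex e).2)
    (hpending : ∀ f, IsGreedy C f → ∀ k, (ofLex (f k)).1 ∈ pending f k (ofLex (f k)).2) :
    ∃! a : DFSRun n, IsGreedy C a.step := by
  have : Nonempty (Fin n → Fin n ×ₗ Fin n) := ⟨fun k => toLex (k, k)⟩
  have hgreatest : ∀ k f, ∃ e, IsGreatest (C k f) e := fun k f =>
    let ⟨e, he, hmax⟩ := Set.exists_max_image (C k f) id (Set.toFinite _) (hnonempty k f)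
    ⟨e, he, hmax⟩
  obtain ⟨f, hf, hunique⟩ := existsUnique_isGreedy hC hgreatest
  obtain ⟨a, rfl⟩ := exists_step_eq (fun k => hfresh k f _ (hf k).1) (hpending f hf)
  exact ⟨a, hf, fun b hb => step_injective (hunique _ hb)⟩

end DFSRun

namespace DFSRun

variable {a : DFSRun n} {T : LabeledTree n}

section PlaneTree

variable (hT : ∀ k, T.par k.succ = (a.parent k).castSucc)

include hT

theorem treeLE_iff {v w : Fin (n + 1)} :
    T.TreeLE v w ↔
      v ≤ w ∧ ∀ u : Fin n, v < u.succ → u.succ ≤ w → v ≤ (a.parent u).castSucc := by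
  induction w using WellFoundedLT.induction with
  | _ w ih =>
    rcases Fin.eq_zero_or_eq_succ w with rfl | ⟨k, rfl⟩
    · simp [T.treeLE_zero_iff, Fin.succ_ne_zero]
    have hlt : (a.parent k).castSucc < k.succ := Fin.castSucc_lt_succ_iff.2 (a.parent_le k)
    rw [T.treeLE_iff_eq_or_treeLE_par (Fin.succ_ne_zero k), hT, ih _ hlt]
    constructor
    · rintro (rfl | ⟨hv, h⟩)
      · exact ⟨le_rfl, fun u hvu huk => absurd hvu huk.not_gt⟩
      · refine ⟨hv.trans hlt.le, fun u hvu huk => ?_⟩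
        rcases le_or_gt u.succ (a.parent k).castSucc with hu | hu
        · exact h u hvu hu
        · exact hv.trans <| Fin.castSucc_le_castSucc_iff.2 <|
            a.parent_le_parent (Fin.succ_le_succ_iff.1 huk) (Fin.castSucc_lt_succ_iff.1 hu)
    · rintro ⟨hv, h⟩
      exact hv.eq_or_lt.imp_right fun hv =>
        ⟨h k hv le_rfl, fun u hvu hu => h u hvu (hu.trans hlt.le)⟩

theorem treeLE_succ_iff {i k : Fin n} :
    T.TreeLE i.succ k.succ ↔ i ≤ k ∧ ∀ u, i < u → u ≤ k → a.parent i < a.parent u := by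
  simp only [treeLE_iff hT, Fin.succ_le_succ_iff, Fin.succ_lt_succ_iff, Fin.succ_le_castSucc_iff]
  refine and_congr_right fun _ => forall₃_congr fun u hiu _ => ⟨(a.parent_le i).trans_lt, ?_⟩
  intro h
  by_contra! hui
  exact (a.parent_le_parent hiu.le hui).not_gt h

theorem isPlane : T.IsPlane := by
  refine ⟨fun i j h => ((treeLE_succ_iff hT).1 h).1, fun i j k hij hjk h => ?_⟩
  rw [treeLE_succ_iff hT] at h ⊢
  exact ⟨hij.le, fun u hiu huj => h.2 u hiu (huj.trans hjk.le)⟩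

end PlaneTree

theorem exists_RPT_par_eq (a : DFSRun n) :
    ∃ T : RPT n, ∀ k, T.1.par k.succ = (a.parent k).castSucc :=
  let ⟨T, hT⟩ := exists_labeledTree_par_eq (rank := id) fun k =>
    Fin.castSucc_lt_succ_iff.2 (a.parent_le k)
  ⟨⟨T, isPlane hT⟩, hT⟩

/-- The rooted plane tree of a run, whose vertices are numbered in the order of discovery. -/
noncomputable def tree (a : DFSRun n) : RPT n := (exists_RPT_par_eq a).choose

theorem par_tree (a : DFSRun n) (k : Fin n) : a.tree.1.par k.succ = (a.parent k).castSucc :=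
  (exists_RPT_par_eq a).choose_spec k

theorem parent_tree (a : DFSRun n) : a.tree.parent = a.parent :=
  funext fun k => Fin.castSucc_injective _ (a.par_tree k)

/-- The admissible vertex order of a run, which compares the labels. -/
noncomputable def order (a : DFSRun n) : AVO a.tree.1 where
  val i j := a.label i < a.label j
  property := by
    refine ⟨a.label.injective.isStrictTotalOrder_onFun (r := (· < ·)), fun i j hij hpar => ?_⟩
    rw [a.par_tree, a.par_tree, Fin.castSucc_inj] at hpar
    simpa [Prod.Lex.toLex_lt_toLex, hpar] using a.lex_lt i j hij (hpar ▸ a.parent_le i)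

end DFSRun

theorem existsUnique_equiv_fin_lt_iff {ι : Type*} [Fintype ι] (hι : Fintype.card ι = n)
    (r : ι → ι → Prop) [IsStrictTotalOrder ι r] :
    ∃! σ : ι ≃ Fin n, ∀ i j, σ i < σ j ↔ r i j := by
  classical
  let := linearOrderOfSTO r
  let σ : Fin n ≃o ι := Fintype.orderIsoFinOfCardEq ι hι
  refine ⟨σ.symm.toEquiv, fun i j => σ.symm.lt_iff_lt, fun τ hτ => ?_⟩
  let τ' : ι ≃o Fin n := StrictMono.orderIsoOfSurjective τ (fun i j => (hτ i j).2) τ.surjective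
  have h : σ.trans τ' = OrderIso.refl _ := Subsingleton.elim _ _
  exact Equiv.ext fun i => calc
    τ i = τ (σ (σ.symm i)) := by rw [σ.apply_symm_apply]
    _ = σ.symm i := DFunLike.congr_fun h (σ.symm i)

theorem DFSRun.bijective_tree_order :
    Function.Bijective fun a : DFSRun n => (⟨a.tree, a.order⟩ : Σ T : RPT n, AVO T.1) := by
  constructor
  · intro a b hab
    have hparent := congrArg (fun s : Σ T : RPT n, AVO T.1 => s.1.parent) hab
    have horder := congrArg (fun s : Σ T : RPT n, AVO T.1 => s.2.1) hab
    simp only [parent_tree] at hparent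
    have := b.order.2.1
    have hunique := existsUnique_equiv_fin_lt_iff (Fintype.card_fin n) b.order.1
    exact DFSRun.ext hparent <|
      hunique.unique (fun i j => (congrFun₂ horder i j).to_iff) fun i j => Iff.rfl
  · rintro ⟨T, r, hr, hsiblings⟩
    obtain ⟨σ, hσ, -⟩ := existsUnique_equiv_fin_lt_iff (Fintype.card_fin n) r
    have lex_lt : ∀ u k, u < k → T.parent k ≤ u →
        toLex (T.parent k, σ k) < toLex (T.parent u, σ u) := fun u k huk hku => by
      rw [Prod.Lex.toLex_lt_toLex]
      exact (T.parent_le_parent huk.le hku).lt_or_eq.imp_right fun h =>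
        ⟨h, (hσ k u).2 (hsiblings u k huk (congrArg Fin.castSucc h.symm))⟩
    let a : DFSRun n := ⟨T.parent, σ, T.parent_le, lex_lt⟩
    exact ⟨a, Sigma.subtype_ext (Subtype.ext (LabeledTree.ext_par a.par_tree))
      (funext₂ fun i j => propext (hσ i j))⟩

theorem sum_RPT_AVO {M : Type*} [AddCommMonoid M] (f : (T : RPT n) → AVO T.1 → M) :
    ∑ T : RPT n, ∑ r : AVO T.1, f T r = ∑ a : DFSRun n, f a.tree a.order := by
  rw [← Fintype.sum_sigma']
  exact (Fintype.sum_bijective _ DFSRun.bijective_tree_order _ _ fun a => rfl).symm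

/-! ### Inversions and pending vertices -/

/-- The total weight of the pending vertices smaller than `v`. -/
def pendingWeight (x : Fin n → ℕ) (f : Fin n → Fin n ×ₗ Fin n) (k v l : Fin n) : ℕ :=
  ∑ w ∈ pending f k l with w < v, x w

namespace DFSRun

variable {a : DFSRun n}

/-- The total weight of the vertices smaller than the parent that were pending when the step `k`
of the run was made. -/
def weight (a : DFSRun n) (x : Fin n → ℕ) (k : Fin n) : ℕ :=
  pendingWeight x a.step k (a.parent k) (a.label k)

theorem exists_last_parent_le (a : DFSRun n) {v k : Fin n} (hvk : v ≤ k) :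
    ∃ i, v ≤ i ∧ i ≤ k ∧ a.parent i ≤ v ∧ ∀ u, i < u → u ≤ k → v < a.parent u := by
  obtain ⟨i, ⟨hik, hiv⟩, hmax⟩ := Set.exists_max_image {i | i ≤ k ∧ a.parent i ≤ v} id
    (Set.toFinite _) ⟨v, hvk, a.parent_le v⟩
  exact ⟨i, hmax v ⟨hvk, a.parent_le v⟩, hik, hiv, fun u hiu huk =>
    not_le.1 fun h => (hmax u ⟨huk, h⟩).not_gt hiu⟩

theorem parent_mem_pending_iff {i k l : Fin n} (hik : i < k)
    (hparent : ∀ u, i < u → u ≤ k → a.parent i < a.parent u) :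
    a.parent i ∈ pending a.step k l ↔ l < a.label i := by
  rw [mem_pending]
  constructor
  · rintro ⟨-, h⟩
    simpa [step, Prod.Lex.toLex_lt_toLex] using h i hik (a.parent_le i)
  · refine fun h => ⟨(a.parent_le i).trans hik.le, fun u huk hiu => ?_⟩
    have hi : toLex (a.parent i, l) < a.step i := Prod.Lex.toLex_lt_toLex.2 (Or.inr ⟨rfl, h⟩)
    rcases lt_trichotomy u i with hui | rfl | hui
    · exact hi.trans (a.lex_lt u i hui hiu)
    · exact hi
    · exact Prod.Lex.toLex_lt_toLex.2 (Or.inl (hparent u hui huk.le))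

/-- The inverse sends a skipped vertex `v` to its child among the ancestors of `k.succ`, which is
the last vertex up to `k.succ` attached to a vertex not larger than `v`. -/
theorem bijOn_parent (a : DFSRun n) (k : Fin n) :
    Set.BijOn a.parent {i | a.tree.1.TreeLE i.succ k.succ ∧ a.order.1 k i}
      {v | v ∈ pending a.step k (a.label k) ∧ v < a.parent k} := by
  simp only [treeLE_succ_iff a.par_tree]
  refine ⟨?_, ?_, ?_⟩
  · rintro i ⟨⟨hik, hparent⟩, hlabel⟩
    have hik : i < k := hik.lt_of_ne (by rintro rfl; exact lt_irrefl _ hlabel)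
    exact ⟨(parent_mem_pending_iff hik hparent).2 hlabel, hparent k hik le_rfl⟩
  · rintro i ⟨⟨hik, hi⟩, -⟩ j ⟨⟨hjk, hj⟩, -⟩ hij
    rcases lt_trichotomy i j with h | h | h
    · exact absurd hij (hi j h hjk).ne
    · exact h
    · exact absurd hij (hj i h hik).ne'
  · rintro v ⟨hv, hvk⟩
    obtain ⟨i, hvi, hik, hiv, hlast⟩ := a.exists_last_parent_le (mem_pending.1 hv).1
    have hik' : i < k := hik.lt_of_ne (by rintro rfl; exact hiv.not_gt hvk)
    obtain rfl : a.parent i = v := by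
      have hlex := Prod.Lex.toLex_lt_toLex.1 ((mem_pending.1 hv).2 i hik' hvi)
      exact hiv.antisymm (hlex.elim le_of_lt fun h => h.1.le)
    exact ⟨i, ⟨⟨hik, hlast⟩, (parent_mem_pending_iff hik' hlast).1 hv⟩, rfl⟩

theorem sum_inversions (a : DFSRun n) (x : Fin n → ℕ) :
    ∑ p ∈ a.tree.1.inversions a.order.1, parEntry x a.tree p.1 = ∑ k, a.weight x k := by
  have hentry : ∀ i, parEntry x a.tree i = x (a.parent i) := fun i =>
    congrArg x (congrFun a.parent_tree i)
  classical
  rw [LabeledTree.inversions, Finset.sum_filter, ← Finset.univ_product_univ,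
    Finset.sum_product_right]
  refine Finset.sum_congr rfl fun k _ => ?_
  rw [← Finset.sum_filter]
  have hbij := a.bijOn_parent k
  refine Finset.sum_nbij a.parent ?_ ?_ ?_ fun i _ => hentry i
  · intro i hi
    simpa using hbij.mapsTo (by simpa using hi)
  · simpa using hbij.injOn
  · simpa using hbij.surjOn

end DFSRun

/-! ### Labeled trees as depth-first searches -/

/-- The labels of all vertices, when the vertex `i.succ` carries the label `σ i`. The label `l`
names the vertex `l.succ` of the labeled tree, and the root is named `0`. -/
def vertexLabel (σ : Fin n → Fin n) : Fin (n + 1) → Fin (n + 1) :=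
  Fin.cons 0 fun i => (σ i).succ

@[simp] theorem vertexLabel_zero (σ : Fin n → Fin n) : vertexLabel σ 0 = 0 := rfl

@[simp] theorem vertexLabel_succ (σ : Fin n → Fin n) (i : Fin n) :
    vertexLabel σ i.succ = (σ i).succ := rfl

theorem vertexLabel_injective {σ : Fin n → Fin n} (hσ : Function.Injective σ) :
    Function.Injective (vertexLabel σ) :=
  Fin.cons_injective_iff.2
    ⟨fun ⟨_, hi⟩ => Fin.succ_ne_zero _ hi, (Fin.succ_injective n).comp hσ⟩

theorem vertexLabel_castSucc_congr {σ τ : Fin n → Fin n} {k v : Fin n}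
    (h : ∀ u < k, σ u = τ u) (hv : v ≤ k) :
    vertexLabel σ v.castSucc = vertexLabel τ v.castSucc := by
  rcases Fin.eq_zero_or_eq_succ v.castSucc with hm | ⟨m, hm⟩
  · rw [hm, vertexLabel_zero, vertexLabel_zero]
  · have hmk : m < k := (Fin.succ_le_castSucc_iff.1 hm.ge).trans_le hv
    rw [hm, vertexLabel_succ, vertexLabel_succ, h m hmk]

/-- The possible steps `k` of a depth-first search of `T` whose earlier steps are those of `f`:
the pairs of a discovered vertex and a fresh label of one of its children. -/
def treeSteps (T : LabeledTree n) (k : Fin n) (f : Fin n → Fin n ×ₗ Fin n) :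
    Set (Fin n ×ₗ Fin n) :=
  {e | IsFresh f k (ofLex e).2 ∧ (ofLex e).1 ≤ k ∧
    T.par (ofLex e).2.succ = vertexLabel (fun u => (ofLex (f u)).2) (ofLex e).1.castSucc}

section TreeSteps

variable {T : LabeledTree n}

theorem treeSteps_congr {k : Fin n} {f g : Fin n → Fin n ×ₗ Fin n} (h : ∀ u < k, f u = g u) :
    treeSteps T k f = treeSteps T k g :=
  Set.ext fun _ => and_congr (isFresh_congr h) <| and_congr_right fun hk => by
    rw [vertexLabel_castSucc_congr (fun u hu => by rw [h u hu]) hk]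

theorem nonempty_treeSteps (T : LabeledTree n) (k : Fin n) (f : Fin n → Fin n ×ₗ Fin n) :
    (treeSteps T k f).Nonempty := by
  obtain ⟨l₀, -, hl₀⟩ := exists_le_forall_lt_ne k (fun u => (ofLex (f u)).2)
    Function.injective_id
  obtain ⟨l, hl, hmin⟩ := Set.exists_min_image {l | IsFresh f k l}
    (fun l => (T.pathToRoot l.succ).length) (Set.toFinite _) ⟨l₀, hl₀⟩
  rcases Fin.eq_zero_or_eq_succ (T.par l.succ) with h0 | ⟨m, hm⟩
  · have : NeZero n := ⟨k.pos.ne'⟩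
    exact ⟨toLex (0, l), hl, Fin.zero_le k, by simp [h0]⟩
  · have hlt :=
      LabeledTree.TreeLE.length_lt (T.treeLE_par l.succ) (T.par_ne (Fin.succ_ne_zero l))
    have hused : ¬ IsFresh f k m := fun h => (hmin m h).not_gt (hm ▸ hlt)
    obtain ⟨u, huk, hu⟩ : ∃ u < k, (ofLex (f u)).2 = m := by simpa [IsFresh] using hused
    have huk' : u.succ ≤ k.castSucc := Fin.succ_le_castSucc_iff.2 huk
    obtain ⟨v, hv⟩ := Fin.exists_castSucc_eq.2 (huk'.trans_lt (Fin.castSucc_lt_last k)).ne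
    refine ⟨toLex (v, l), hl, Fin.castSucc_le_castSucc_iff.1 (hv ▸ huk'), ?_⟩
    simp only [ofLex_toLex, hv, hm, vertexLabel_succ, hu]

theorem IsGreedy.mem_pending_of_treeSteps {f : Fin n → Fin n ×ₗ Fin n}
    (hf : IsGreedy (treeSteps T) f) (k : Fin n) :
    (ofLex (f k)).1 ∈ pending f k (ofLex (f k)).2 := by
  obtain ⟨hfresh, hle, hpar⟩ := (hf k).1
  refine mem_pending.2 ⟨hle, fun u huk hvu => lt_of_le_of_ne ?_ ?_⟩
  · exact (hf u).2 ⟨fun w hwu => hfresh w (hwu.trans huk), hvu, hpar⟩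
  · exact fun h => hfresh u huk (congrArg (fun e => (ofLex e).2) h.symm)

end TreeSteps

namespace DFSRun

theorem exists_labeledTree_par_label (a : DFSRun n) : ∃ T : LabeledTree n, ∀ k,
    T.par (a.label k).succ = vertexLabel a.label (a.parent k).castSucc := by
  have hinv : Function.LeftInverse (vertexLabel a.label.symm) (vertexLabel a.label) := fun v => by
    rcases Fin.eq_zero_or_eq_succ v with rfl | ⟨i, rfl⟩ <;> simp
  obtain ⟨T, hT⟩ := exists_labeledTree_par_eq (rank := vertexLabel a.label.symm)
    (p := fun l => vertexLabel a.label (a.parent (a.label.symm l)).castSucc) fun l => by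
      rw [hinv, vertexLabel_succ]
      exact Fin.castSucc_lt_succ_iff.2 (a.parent_le _)
  exact ⟨T, fun k => by simp [hT]⟩

/-- The labeled tree of a run, whose vertices are named by their labels. -/
noncomputable def labeledTree (a : DFSRun n) : LabeledTree n :=
  (exists_labeledTree_par_label a).choose

theorem par_labeledTree (a : DFSRun n) (k : Fin n) :
    a.labeledTree.par (a.label k).succ = vertexLabel a.label (a.parent k).castSucc :=
  (exists_labeledTree_par_label a).choose_spec k

theorem isGreedy_treeSteps_iff {a : DFSRun n} {T : LabeledTree n} :
    IsGreedy (treeSteps T) a.step ↔ a.labeledTree = T := by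
  constructor
  · refine fun h => LabeledTree.ext_par fun l => ?_
    obtain ⟨k, rfl⟩ := a.label.surjective l
    exact (a.par_labeledTree k).trans (h k).1.2.2.symm
  · rintro rfl k
    refine ⟨⟨a.isFresh_label k, a.parent_le k, a.par_labeledTree k⟩, ?_⟩
    rintro ⟨v, l⟩ ⟨hfresh, hvk, hpar⟩
    obtain ⟨j, hkj, rfl⟩ := exists_label_eq_of_isFresh hfresh
    obtain rfl : a.parent j = v := Fin.castSucc_injective _ <|
      vertexLabel_injective a.label.injective ((a.par_labeledTree j).symm.trans hpar)
    rcases hkj.eq_or_lt with rfl | hkj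
    · exact le_rfl
    · exact (a.lex_lt k j hkj hvk).le

theorem bijective_labeledTree : Function.Bijective (labeledTree : DFSRun n → LabeledTree n) :=
  (Function.bijective_iff_existsUnique _).2 fun T => by
    simpa only [isGreedy_treeSteps_iff] using existsUnique_isGreedy_step
      (fun _ _ _ => treeSteps_congr) (nonempty_treeSteps T) (fun _ _ _ he => he.1)
      fun _ hf => hf.mem_pending_of_treeSteps

theorem treeLE_labeledTree (a : DFSRun n) (v w : Fin (n + 1)) :
    a.labeledTree.TreeLE (vertexLabel a.label v) (vertexLabel a.label w) ↔
      a.tree.1.TreeLE v w := by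
  have hinj := vertexLabel_injective a.label.injective
  induction w using WellFoundedLT.induction with
  | _ w ih =>
    rcases Fin.eq_zero_or_eq_succ w with rfl | ⟨k, rfl⟩
    · rw [vertexLabel_zero, LabeledTree.treeLE_zero_iff, LabeledTree.treeLE_zero_iff]
      exact hinj.eq_iff (b := 0)
    · have hparent := ih _ (Fin.castSucc_lt_succ_iff.2 (a.parent_le k))
      rw [a.tree.1.treeLE_iff_eq_or_treeLE_par (Fin.succ_ne_zero k), a.par_tree, vertexLabel_succ,
        a.labeledTree.treeLE_iff_eq_or_treeLE_par (Fin.succ_ne_zero _), a.par_labeledTree,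
        ← vertexLabel_succ]
      exact or_congr hinj.eq_iff hparent

theorem inv_labeledTree (a : DFSRun n) :
    a.labeledTree.inv = (a.tree.1.inversions a.order.1).card := by
  refine Finset.card_equiv ((a.label.symm.prodCongr a.label.symm).trans (Equiv.prodComm _ _)) ?_
  rintro ⟨i, j⟩
  obtain ⟨i, rfl⟩ := a.label.surjective i
  obtain ⟨j, rfl⟩ := a.label.surjective j
  have htree := a.treeLE_labeledTree j.succ i.succ
  have horder : a.order.1 i j ↔ a.label i < a.label j := Iff.rfl
  simp only [vertexLabel_succ] at htree
  simp [LabeledTree.inversions, htree, horder, and_comm]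

end DFSRun

/-! ### Parking functions as depth-first searches -/

theorem isVectorParkingFunction_iff {x α : Fin n → ℕ} :
    IsVectorParkingFunction x α ↔ ∀ j, α (Tuple.sort α j) < ∑ v ∈ Finset.Iic j, x v := by
  refine forall_congr' fun j => ?_
  rw [Int.le_sub_one_iff]
  norm_cast

theorem sum_Iic_mono {ι M : Type*} [Preorder ι] [LocallyFiniteOrderBot ι] [AddCommMonoid M]
    [PartialOrder M] [IsOrderedAddMonoid M] [CanonicallyOrderedAdd M] (x : ι → M) :
    Monotone fun k => ∑ v ∈ Finset.Iic k, x v :=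
  fun _ _ h => Finset.sum_le_sum_of_subset (Finset.Iic_subset_Iic.2 h)

theorem IsVectorParkingFunction.of_perm {x α : Fin n → ℕ} (σ : Equiv.Perm (Fin n))
    (h : ∀ k, α (σ k) < ∑ v ∈ Finset.Iic k, x v) : IsVectorParkingFunction x α := by
  refine isVectorParkingFunction_iff.2 fun j => ?_
  obtain ⟨u, huj, hu⟩ := exists_le_forall_lt_ne j (Tuple.sort α) σ.injective
  obtain ⟨i, hi⟩ := (Tuple.sort α).surjective (σ u)
  have hji : j ≤ i := not_lt.1 fun hij => hu i hij hi
  calc α (Tuple.sort α j) ≤ α (Tuple.sort α i) := Tuple.monotone_sort α hji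
    _ = α (σ u) := by rw [hi]
    _ < ∑ v ∈ Finset.Iic u, x v := h u
    _ ≤ ∑ v ∈ Finset.Iic j, x v := sum_Iic_mono x huj

theorem pendingWeight_add {x : Fin n → ℕ} {f : Fin n → Fin n ×ₗ Fin n} {k v l : Fin n}
    (hv : v ∈ pending f k l) :
    pendingWeight x f k v l + x v = ∑ w ∈ pending f k l with w ≤ v, x w := by
  have hinsert : {w ∈ pending f k l | w ≤ v} = insert v {w ∈ pending f k l | w < v} := by
    ext w
    simp only [Finset.mem_filter, Finset.mem_insert, le_iff_eq_or_lt]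
    grind
  rw [hinsert, Finset.sum_insert (by simp), add_comm, pendingWeight]

/-- The possible steps `k` of a depth-first search encoding `α` whose earlier steps are those of
`f`. The pending vertices `w` are laid out in increasing order as consecutive segments of length
`x w` starting from `α l`, and `l` may be attached to `v` when the segment of `v` starts before
`x 0 + ⋯ + x k`. -/
def parkingSteps (x α : Fin n → ℕ) (k : Fin n) (f : Fin n → Fin n ×ₗ Fin n) :
    Set (Fin n ×ₗ Fin n) :=
  {e | IsFresh f k (ofLex e).2 ∧ (ofLex e).1 ∈ pending f k (ofLex e).2 ∧
    pendingWeight x f k (ofLex e).1 (ofLex e).2 + α (ofLex e).2 < ∑ w ∈ Finset.Iic k, x w}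

section ParkingSteps

variable {x α : Fin n → ℕ} {f g : Fin n → Fin n ×ₗ Fin n} {k l : Fin n}

theorem parkingSteps_congr (h : ∀ u < k, f u = g u) :
    parkingSteps x α k f = parkingSteps x α k g :=
  Set.ext fun _ => and_congr (isFresh_congr h) <| by
    rw [pendingWeight, pendingWeight, pending_congr h]

theorem nonempty_parkingSteps (hα : IsVectorParkingFunction x α) (k : Fin n)
    (f : Fin n → Fin n ×ₗ Fin n) : (parkingSteps x α k f).Nonempty := by
  obtain ⟨j, hjk, hfresh⟩ := exists_le_forall_lt_ne k (fun u => (ofLex (f u)).2)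
    (Tuple.sort α).injective
  set l := Tuple.sort α j
  obtain ⟨v, hv, hmin⟩ := (pending f k l).exists_min_image id ⟨k, self_mem_pending f k l⟩
  replace hmin : ∀ w ∈ pending f k l, v ≤ w := hmin
  have hweight : pendingWeight x f k v l = 0 := by
    rw [pendingWeight, Finset.filter_false_of_mem fun w hw => (hmin w hw).not_gt, Finset.sum_empty]
  refine ⟨toLex (v, l), hfresh, hv, ?_⟩
  simpa only [ofLex_toLex, hweight, zero_add] using
    (isVectorParkingFunction_iff.1 hα j).trans_le (sum_Iic_mono x hjk)

theorem pending_of_covBy {k' : Fin n} (h : k ⋖ k') (f : Fin n → Fin n ×ₗ Fin n) (l : Fin n) :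
    pending f k' l = insert k' {v ∈ pending f k l | toLex (v, l) < f k} := by
  have hlt : ∀ u, u < k' ↔ u ≤ k := fun u => Set.ext_iff.1 h.Iio_eq u
  ext v
  simp only [Finset.mem_insert, Finset.mem_filter, mem_pending, hlt, le_iff_eq_or_lt (b := k')]
  grind

theorem sum_Iic_of_covBy {ι M : Type*} [LinearOrder ι] [LocallyFiniteOrderBot ι] [AddCommMonoid M]
    {k k' : ι} (h : k ⋖ k') (x : ι → M) :
    ∑ w ∈ Finset.Iic k', x w = x k' + ∑ w ∈ Finset.Iic k, x w := by
  have hIio : Finset.Iio k' = Finset.Iic k := by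
    simpa [← Finset.coe_inj] using h.Iio_eq
  rw [← Finset.Iio_insert, Finset.sum_insert (by simp), hIio]

namespace IsGreedy

variable (hf : IsGreedy (parkingSteps x α) f)

include hf

theorem sum_Iic_le_add_sum_filter (hl : IsFresh f k l)
    (h : ∑ w ∈ Finset.Iic k, x w ≤ ∑ w ∈ pending f k l, x w + α l) :
    ∑ w ∈ Finset.Iic k, x w ≤ ∑ w ∈ pending f k l with toLex (w, l) ≤ f k, x w + α l := by
  by_cases hall : ∀ w ∈ pending f k l, toLex (w, l) ≤ f k
  · rwa [Finset.filter_true_of_mem hall]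
  push Not at hall
  obtain ⟨v, ⟨hv, hlt⟩, hmin⟩ := Set.exists_min_image
    {v | v ∈ pending f k l ∧ f k < toLex (v, l)} id (Set.toFinite _) hall
  -- The first pending vertex beyond the step taken is not a candidate, so the earlier segments
  -- already reach the bound.
  have hnotMem : toLex (v, l) ∉ parkingSteps x α k f := fun h => ((hf k).2 h).not_gt hlt
  calc ∑ w ∈ Finset.Iic k, x w
    _ ≤ pendingWeight x f k v l + α l := not_lt.1 fun h => hnotMem ⟨hl, hv, h⟩
    _ ≤ _ := by
      refine Nat.add_le_add_right (Finset.sum_le_sum_of_subset fun w hw => ?_) _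
      obtain ⟨hw, hwv⟩ := Finset.mem_filter.1 hw
      exact Finset.mem_filter.2 ⟨hw, not_lt.1 fun h => hwv.not_ge (hmin w ⟨hw, h⟩)⟩

/-- The invariant that lets a greedy search never fall short: passing to the next step removes only
segments beyond the step taken, and adds the same new entry of `x` to both sides. -/
theorem sum_Iic_le_sum_pending (hl : IsFresh f k l) :
    ∑ w ∈ Finset.Iic k, x w ≤ ∑ w ∈ pending f k l, x w + α l := by
  induction k using WellFoundedLT.induction with
  | _ k' ih =>
    by_cases hmin : IsMin k'
    · have hIic : Finset.Iic k' = {k'} := by simpa [← Finset.coe_inj] using hmin.Iic_eq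
      rw [hIic, Finset.sum_singleton]
      exact le_add_right (Finset.single_le_sum (fun _ _ => Nat.zero_le _) (self_mem_pending f k' l))
    · obtain ⟨k, hk⟩ := exists_covBy_of_wellFoundedGT hmin
      have hlk : IsFresh f k l := fun u hu => hl u (hu.trans hk.lt)
      have hne : ∀ w, toLex (w, l) ≠ f k := fun w h =>
        hl k hk.lt (congrArg (fun e => (ofLex e).2) h.symm)
      have hle := hf.sum_Iic_le_add_sum_filter hlk (ih k hk.lt hlk)
      simp only [(hne _).le_iff_lt] at hle
      have hnotMem : k' ∉ {w ∈ pending f k l | toLex (w, l) < f k} := fun h =>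
        (mem_pending.1 (Finset.mem_filter.1 h).1).1.not_gt hk.lt
      rw [sum_Iic_of_covBy hk, pending_of_covBy hk, Finset.sum_insert hnotMem, add_assoc]
      exact Nat.add_le_add_left hle _

end IsGreedy

end ParkingSteps

namespace DFSRun

variable {a : DFSRun n} {x α : Fin n → ℕ}

theorem weight_add_parent (a : DFSRun n) (x : Fin n → ℕ) (k : Fin n) :
    a.weight x k + x (a.parent k) =
      ∑ w ∈ pending a.step k (a.label k) with w ≤ a.parent k, x w :=
  pendingWeight_add (a.parent_mem_pending k)

/-- The parking functions encoded by a run: the value at the label of the step `k` ranges over an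
interval of length `x (a.parent k)`, see `mem_parkingFunctions`. -/
def parkingFunctions (a : DFSRun n) (x : Fin n → ℕ) : Finset (Fin n → ℕ) :=
  Fintype.piFinset fun l =>
    let k := a.label.symm l
    Finset.Ico (∑ w ∈ Finset.Iic k, x w - (a.weight x k + x (a.parent k)))
      (∑ w ∈ Finset.Iic k, x w - a.weight x k)

theorem mem_parkingFunctions : α ∈ a.parkingFunctions x ↔
    ∀ k, a.weight x k + α (a.label k) < ∑ w ∈ Finset.Iic k, x w ∧
      ∑ w ∈ Finset.Iic k, x w ≤ a.weight x k + x (a.parent k) + α (a.label k) := by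
  rw [parkingFunctions, Fintype.mem_piFinset, ← a.label.forall_congr_right]
  refine forall_congr' fun k => ?_
  simp only [a.label.symm_apply_apply, Finset.mem_Ico]
  omega

theorem isVectorParkingFunction_of_mem (h : α ∈ a.parkingFunctions x) :
    IsVectorParkingFunction x α :=
  IsVectorParkingFunction.of_perm a.label fun k =>
    (Nat.le_add_left _ _).trans_lt (mem_parkingFunctions.1 h k).1

theorem filter_pending_subset {j k v l : Fin n} (hkj : k ≤ j) (hl : l = a.label j)
    (h : a.step k < toLex (v, l)) :
    {w ∈ pending a.step j l | w ≤ a.parent j} ⊆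
      Finset.Ioc k j ∪ {w ∈ pending a.step k l | w < v} := by
  subst hl
  intro w hw
  obtain ⟨hw, hwj⟩ := Finset.mem_filter.1 hw
  obtain ⟨hwj', hw⟩ := mem_pending.1 hw
  rw [Finset.mem_union, Finset.mem_Ioc, Finset.mem_filter, mem_pending]
  rcases lt_or_ge k w with hkw | hwk
  · exact Or.inl ⟨hkw, hwj'⟩
  refine Or.inr ⟨⟨hwk, fun u huk => hw u (huk.trans_le hkj)⟩, ?_⟩
  have hle : toLex (w, a.label j) ≤ a.step k := by
    rcases hkj.eq_or_lt with rfl | hkj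
    · exact Prod.Lex.toLex_mono ⟨hwj, le_rfl⟩
    · exact (hw k hkj hwk).le
  simpa [Prod.Lex.toLex_lt_toLex] using hle.trans_lt h

theorem isGreedy_of_mem_parkingFunctions (h : α ∈ a.parkingFunctions x) :
    IsGreedy (parkingSteps x α) a.step := by
  rw [mem_parkingFunctions] at h
  refine fun k => ⟨⟨a.isFresh_label k, a.parent_mem_pending k, (h k).1⟩, ?_⟩
  rintro e ⟨hfresh, -, hlt⟩
  by_contra! hstep
  set v := (ofLex e).1
  set l := (ofLex e).2
  -- At the step `j` that discovers the skipped label, the segments up to the parent consist of new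
  -- vertices and of segments before that of `v`, so they end too early.
  obtain ⟨j, hkj, hl⟩ := exists_label_eq_of_isFresh hfresh
  have hIic : ∑ w ∈ Finset.Iic j, x w = ∑ w ∈ Finset.Iic k, x w + ∑ w ∈ Finset.Ioc k j, x w := by
    rw [← Finset.Iic_union_Ioc_eq_Iic hkj, Finset.sum_union (Finset.Iic_disjoint_Ioc le_rfl)]
  have hunion : ∑ w ∈ Finset.Ioc k j ∪ {w ∈ pending a.step k l | w < v}, x w ≤
      ∑ w ∈ Finset.Ioc k j, x w + pendingWeight x a.step k v l :=
    (Nat.le_add_right _ _).trans Finset.sum_union_inter.le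
  have hle : ∑ w ∈ Finset.Iic j, x w ≤
      ∑ w ∈ Finset.Ioc k j, x w + pendingWeight x a.step k v l + α l := by
    calc ∑ w ∈ Finset.Iic j, x w
      _ ≤ ∑ w ∈ pending a.step j l with w ≤ a.parent j, x w + α l := by
        simpa only [hl, a.weight_add_parent] using (h j).2
      _ ≤ _ := Nat.add_le_add_right ((Finset.sum_le_sum_of_subset
        (filter_pending_subset hkj hl.symm hstep)).trans hunion) _
  omega

theorem mem_parkingFunctions_of_isGreedy (h : IsGreedy (parkingSteps x α) a.step) :
    α ∈ a.parkingFunctions x := by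
  refine mem_parkingFunctions.2 fun k => ⟨(h k).1.2.2, ?_⟩
  have hle := h.sum_Iic_le_add_sum_filter (a.isFresh_label k)
    (h.sum_Iic_le_sum_pending (a.isFresh_label k))
  simpa [step, Prod.Lex.toLex_le_toLex, ← le_iff_lt_or_eq, a.weight_add_parent] using hle

theorem existsUnique_mem_parkingFunctions (hα : IsVectorParkingFunction x α) :
    ∃! a : DFSRun n, α ∈ a.parkingFunctions x := by
  have hiff : ∀ a : DFSRun n, IsGreedy (parkingSteps x α) a.step ↔ α ∈ a.parkingFunctions x :=
    fun _ => ⟨mem_parkingFunctions_of_isGreedy, isGreedy_of_mem_parkingFunctions⟩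
  simpa only [hiff] using existsUnique_isGreedy_step (fun _ _ _ => parkingSteps_congr)
    (nonempty_parkingSteps hα) (fun _ _ _ he => he.1) fun _ hf k => (hf k).1.2.1

end DFSRun

/-! ### Generating functions -/

theorem T_sum {R ι : Type*} [CommSemiring R] (s : Finset ι) (f : ι → ℤ) :
    (LaurentPolynomial.T (∑ i ∈ s, f i) : LaurentPolynomial R) =
      ∏ i ∈ s, LaurentPolynomial.T (f i) := by
  classical
  induction s using Finset.induction_on with
  | empty => simp
  | insert i s hi ih =>
    rw [Finset.sum_insert hi, Finset.prod_insert hi, LaurentPolynomial.T_add, ih]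

theorem sum_Ico_T_sub {S w y : ℕ} (h : w + y ≤ S) :
    ∑ m ∈ Finset.Ico (S - (w + y)) (S - w),
        (LaurentPolynomial.T (S - 1 - m) : LaurentPolynomial ℤ) =
      LaurentPolynomial.T w * qNumber y := by
  rw [qNumber, Finset.mul_sum]
  refine Finset.sum_nbij' (fun m => S - 1 - w - m) (fun i => S - 1 - w - i) ?_ ?_ ?_ ?_ ?_
  · simp only [Finset.mem_Ico, Finset.mem_range]; omega
  · simp only [Finset.mem_Ico, Finset.mem_range]; omega
  · simp only [Finset.mem_Ico]; omega
  · simp only [Finset.mem_range]; omega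
  · intro m hm
    rw [Finset.mem_Ico] at hm
    rw [← LaurentPolynomial.T_add]
    congr 1
    omega

theorem sum_mul_eq_sum_sum_Iic (x : Fin n → ℕ) :
    ∑ i : Fin n, ((n : ℤ) + 1 - ((i : ℤ) + 1)) * (x i : ℤ) =
      ∑ k : Fin n, ∑ v ∈ Finset.Iic k, (x v : ℤ) := by
  rw [Finset.sum_comm' (t' := Finset.univ) (s' := fun v => Finset.Ici v) (by simp)]
  refine Finset.sum_congr rfl fun v _ => ?_
  rw [Finset.sum_const, Fin.card_Ici, nsmul_eq_mul, Nat.cast_sub v.is_lt.le]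
  ring

theorem rsum_eq_sum (x α : Fin n → ℕ) (σ : Equiv.Perm (Fin n)) :
    rsum x α = ∑ l, (((∑ v ∈ Finset.Iic (σ l), x v : ℕ) : ℤ) - 1 - α l) := by
  simp only [Finset.sum_sub_distrib, Finset.sum_const, Finset.card_univ, Fintype.card_fin,
    nsmul_eq_mul, mul_one, rsum, sum_mul_eq_sum_sum_Iic, Nat.cast_sum]
  rw [Equiv.sum_comp σ fun k => ∑ v ∈ Finset.Iic k, (x v : ℤ)]

theorem mem_vectorPF {x α : Fin n → ℕ} : α ∈ vectorPF x ↔ IsVectorParkingFunction x α := by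
  simp [vectorPF]

namespace DFSRun

theorem weight_add_parent_le (a : DFSRun n) (x : Fin n → ℕ) (k : Fin n) :
    a.weight x k + x (a.parent k) ≤ ∑ w ∈ Finset.Iic k, x w := by
  rw [weight_add_parent]
  exact Finset.sum_le_sum_of_subset ((Finset.filter_subset _ _).trans (Finset.filter_subset _ _))

theorem sum_parkingFunctions (a : DFSRun n) (x : Fin n → ℕ) :
    ∑ α ∈ a.parkingFunctions x, (LaurentPolynomial.T (rsum x α) : LaurentPolynomial ℤ) =
      LaurentPolynomial.T (∑ k, (a.weight x k : ℤ)) * ∏ k, qNumber (x (a.parent k)) := by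
  simp only [rsum_eq_sum x _ a.label.symm, T_sum, parkingFunctions]
  rw [← Finset.prod_univ_sum _ fun l m =>
    (LaurentPolynomial.T (((∑ v ∈ Finset.Iic (a.label.symm l), x v : ℕ) : ℤ) - 1 - (m : ℕ)) :
      LaurentPolynomial ℤ)]
  simp only [sum_Ico_T_sub (a.weight_add_parent_le x _)]
  rw [← Finset.prod_mul_distrib]
  exact Equiv.prod_comp a.label.symm fun k =>
    LaurentPolynomial.T (a.weight x k : ℤ) * qNumber (x (a.parent k))

theorem sum_vectorPF {M : Type*} [AddCommMonoid M] (x : Fin n → ℕ) (f : (Fin n → ℕ) → M) :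
    ∑ α ∈ vectorPF x, f α = ∑ a : DFSRun n, ∑ α ∈ a.parkingFunctions x, f α := by
  classical
  have hunion : vectorPF x = Finset.univ.biUnion fun a : DFSRun n => a.parkingFunctions x := by
    ext α
    simp only [mem_vectorPF, Finset.mem_biUnion, Finset.mem_univ, true_and]
    exact ⟨fun h => (existsUnique_mem_parkingFunctions h).exists,
      fun ⟨_, h⟩ => isVectorParkingFunction_of_mem h⟩
  rw [hunion, Finset.sum_biUnion]
  intro a _ b _ hab
  exact Finset.disjoint_left.2 fun α ha hb => hab <|
    (existsUnique_mem_parkingFunctions (isVectorParkingFunction_of_mem ha)).unique ha hb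

theorem prod_pow_outdeg {M : Type*} [CommMonoid M] (a : DFSRun n) (f : Fin n → M) :
    ∏ i, f i ^ a.tree.1.outdeg i.castSucc = ∏ k, f (a.parent k) := by
  classical
  rw [← Finset.prod_fiberwise' Finset.univ a.parent f]
  refine Finset.prod_congr rfl fun i _ => ?_
  simp only [Finset.prod_const, LabeledTree.outdeg, a.par_tree, Fin.castSucc_inj]

end DFSRun

theorem sum_vectorPF_eq_sum_RPT (x : Fin n → ℕ) :
    ∑ α ∈ vectorPF x, (LaurentPolynomial.T (rsum x α) : LaurentPolynomial ℤ) =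
      ∑ T : RPT n,
        (∑ r : AVO T.1,
          (LaurentPolynomial.T (∑ p ∈ T.1.inversions r.1, (parEntry x T p.1 : ℤ)) :
            LaurentPolynomial ℤ)) *
        ∏ i : Fin n, qNumber (x i) ^ T.1.outdeg i.castSucc := by
  simp only [Finset.sum_mul]
  rw [sum_RPT_AVO, DFSRun.sum_vectorPF]
  refine Finset.sum_congr rfl fun a _ => ?_
  rw [a.sum_parkingFunctions, a.prod_pow_outdeg fun i => qNumber (x i), ← Nat.cast_sum,
    ← Nat.cast_sum, a.sum_inversions]

theorem vectorPF_one (n : ℕ) : vectorPF (fun _ : Fin n => 1) = classicalPF n := by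
  ext α
  rw [mem_vectorPF, isVectorParkingFunction_iff]
  simp [classicalPF, IsParkingFunction]

theorem rsum_one (α : Fin n → ℕ) : rsum (fun _ => 1) α = classicalRsum α := by
  have hsum : ∑ k : Fin n, (k : ℤ) = n.choose 2 := by
    rw [Fin.sum_univ_eq_sum_range fun i => (i : ℤ), ← Nat.cast_sum, Finset.sum_range_id,
      Nat.choose_two_right]
  rw [rsum, classicalRsum, sum_mul_eq_sum_sum_Iic]
  simp [Finset.sum_add_distrib, hsum]

theorem sum_vectorPF_one_eq_sum_classicalPF (n : ℕ) :
    ∑ α ∈ vectorPF (fun _ : Fin n => 1),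
        (LaurentPolynomial.T (rsum (fun _ => 1) α) : LaurentPolynomial ℤ) =
      ∑ α ∈ classicalPF n, LaurentPolynomial.T (classicalRsum α) := by
  simp only [vectorPF_one, rsum_one]

theorem sum_RPT_one_eq_sum_labeledTree (n : ℕ) :
    ∑ T : RPT n,
        (∑ r : AVO T.1,
          (LaurentPolynomial.T (∑ p ∈ T.1.inversions r.1, (parEntry (fun _ => 1) T p.1 : ℤ)) :
            LaurentPolynomial ℤ)) *
        ∏ i : Fin n, qNumber 1 ^ T.1.outdeg i.castSucc =
      ∑ T : LabeledTree n, LaurentPolynomial.T (T.inv : ℤ) := by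
  have hone : qNumber 1 = 1 := by simp [qNumber]
  simp only [hone, one_pow, Finset.prod_const_one, mul_one]
  rw [sum_RPT_AVO]
  refine Fintype.sum_bijective _ DFSRun.bijective_labeledTree _ _ fun a => ?_
  simp [a.inv_labeledTree, parEntry]

end VectorParking

theorem mainTheorem1 (n : ℕ) :
    -- the identity for every vector `x`
    (∀ x : Fin n → ℕ,
      ∑ α ∈ vectorPF x, (LaurentPolynomial.T (rsum x α) : LaurentPolynomial ℤ) =
        ∑ T : RPT n,
          (∑ r : AVO T.1,
            (LaurentPolynomial.T (∑ p ∈ T.1.inversions r.1, (parEntry x T p.1 : ℤ)) :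
              LaurentPolynomial ℤ)) *
          ∏ i : Fin n, qNumber (x i) ^ T.1.outdeg i.castSucc) ∧
    -- for `x = (1, …, 1)` the two sides are those of Kreweras's identity
    (∑ α ∈ vectorPF (fun _ : Fin n => 1),
        (LaurentPolynomial.T (rsum (fun _ : Fin n => 1) α) : LaurentPolynomial ℤ) =
      ∑ α ∈ classicalPF n, LaurentPolynomial.T (classicalRsum α)) ∧
    (∑ T : RPT n,
        (∑ r : AVO T.1,
          (LaurentPolynomial.T (∑ p ∈ T.1.inversions r.1,
            (parEntry (fun _ : Fin n => 1) T p.1 : ℤ)) : LaurentPolynomial ℤ)) *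
        ∏ i : Fin n, qNumber 1 ^ T.1.outdeg i.castSucc =
      ∑ T : LabeledTree n, LaurentPolynomial.T (T.inv : ℤ)) ∧
    -- Kreweras's identity
    (∑ α ∈ classicalPF n, (LaurentPolynomial.T (classicalRsum α) : LaurentPolynomial ℤ) =
      ∑ T : LabeledTree n, LaurentPolynomial.T (T.inv : ℤ)) :=
  ⟨sum_vectorPF_eq_sum_RPT, sum_vectorPF_one_eq_sum_classicalPF n,
    sum_RPT_one_eq_sum_labeledTree n,
    (sum_vectorPF_one_eq_sum_classicalPF n).symm.trans
      ((sum_vectorPF_eq_sum_RPT _).trans (sum_RPT_one_eq_sum_labeledTree n))⟩
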